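/- For a complex number $c$ and a positive integer $n$, let $\sigma_c(n)=\sum_{d\mid n} d^c$, the sum being over the positive divisors $d$ of $n$. Let $c=a+bi$ with $a,b$ real, $-1\le a\le 0$ and $b\neq 0$. Let $D$ be a positive integer, and let $E(D)$ be the set of squarefree positive integers all of whose prime factors are greater than $D$. Then the set $\sigma_c(E(D))=\{\sigma_c(n) : n\in E(D)\}$ is dense in $\mathbb{C}$. -/

import Mathlib

/-- The divisor function `σ_c(n) = ∑_{d ∣ n} d ^ c` with complex exponent `c`
(for `n = 0` the value is the empty sum; only `n ≥ 1` is ever used). -/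
noncomputable def divisorSigma (c : ℂ) (n : ℕ) : ℂ :=
  ∑ d ∈ n.divisors, (d : ℂ) ^ c

/-- The set of squarefree positive integers all of whose prime factors are greater than `D`.
(`0` is not squarefree, so it is excluded; `1` belongs to the set.) -/
def squarefreeRough (D : ℕ) : Set ℕ :=
  {n : ℕ | Squarefree n ∧ ∀ p : ℕ, p.Prime → p ∣ n → D < p}

/-! On squarefree integers `divisorSigma c` is a product of factors 1 + p^c, where p^c = p^a ·
p^(ib). The arithmetic input is `not_summable_inv_prime_arc`: primes with p^(ib) in any fixed arc
have divergent reciprocal sum, because the L-series of Λ has no pole on Re z = 1 except at 1. If a <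
0, then p^c → 0 while the sum of p^a ≥ 1/p over an arc diverges, so sums of log(1 + p^c) can be
steered towards log z, halving the error at each round. If a = 0, the closure of the values is
stable under multiplication by every point of the circle |w - 1| = 1; a nonzero z is a power of a
number near 1, itself a product of two such points. -/

/-! ### Primes p with p^(ib) in an arc -/

open Filter Topology ArithmeticFunction Complex in
/-- Along `Re z = 1`, the `L`-series of `Λ` has a pole only at `z = 1`, with residue `1`. -/
theorem tendsto_mul_LSeries_vonMangoldt (t : ℝ) :
    Tendsto (fun s : ℝ => (s : ℂ) * LSeries (fun n => (vonMangoldt n : ℂ)) (1 + s + t * I))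
      (𝓝[>] 0) (𝓝 (if t = 0 then 1 else 0)) := by
  have hcont : Tendsto (fun s : ℝ => vonMangoldt.LFunctionResidueClassAux (1 : ZMod 1)
      (1 + s + t * I)) (𝓝[>] 0)
      (𝓝 (vonMangoldt.LFunctionResidueClassAux (1 : ZMod 1) (1 + (0 : ℝ) + t * I))) := by
    refine (vonMangoldt.continuousOn_LFunctionResidueClassAux (1 : ZMod 1)
      (1 + (0 : ℝ) + t * I) (by simp)).tendsto.comp ?_
    refine tendsto_nhdsWithin_iff.2 ⟨?_, ?_⟩
    · refine Tendsto.mono_left (Continuous.tendsto ?_ 0) nhdsWithin_le_nhds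
      fun_prop
    · filter_upwards [self_mem_nhdsWithin] with s hs
      simpa using (le_of_lt hs : (0 : ℝ) ≤ s)
  have hs0 : Tendsto (fun s : ℝ => (s : ℂ)) (𝓝[>] 0) (𝓝 0) := by
    have : Tendsto (fun s : ℝ => (s : ℂ)) (𝓝 0) (𝓝 ((0 : ℝ) : ℂ)) := continuous_ofReal.tendsto 0
    simpa using this.mono_left nhdsWithin_le_nhds
  have hpole : Tendsto (fun s : ℝ => (s : ℂ) * (1 / (s + t * I))) (𝓝[>] 0)
      (𝓝 (if t = 0 then 1 else 0)) := by
    split_ifs with ht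
    · refine tendsto_const_nhds.congr' ?_
      filter_upwards [self_mem_nhdsWithin] with s hs
      have : (s : ℂ) ≠ 0 := ofReal_ne_zero.2 (ne_of_gt hs)
      simp [ht, this]
    · have h1 : Tendsto (fun s : ℝ => 1 / ((s : ℂ) + t * I)) (𝓝[>] 0) (𝓝 (1 / (0 + t * I))) :=
        tendsto_const_nhds.div (hs0.add_const _) (by simp [ht])
      simpa using hs0.mul h1
  have := (hs0.mul hcont).add hpole
  rw [zero_mul, zero_add] at this
  refine this.congr' ?_
  filter_upwards [self_mem_nhdsWithin] with s hs
  have hs : (0 : ℝ) < s := hs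
  rw [vonMangoldt.eqOn_LFunctionResidueClassAux (q := 1) (a := 1) isUnit_one
    (show (1 : ℝ) < (1 + s + t * I : ℂ).re by simpa using hs)]
  have hr : (fun n : ℕ => ((vonMangoldt.residueClass (1 : ZMod 1) n : ℝ) : ℂ))
      = fun n => (vonMangoldt n : ℂ) := by
    funext n
    simp [vonMangoldt.residueClass, Set.indicator, Subsingleton.elim (n : ZMod 1) 1]
  simp only [hr, Nat.totient_one, Nat.cast_one, inv_one]
  rw [show (1 + s + t * I - 1 : ℂ) = s + t * I by ring]
  ring

theorem summable_vonMangoldt_div_rpow {x : ℝ} (hx : 1 < x) :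
    Summable fun n : ℕ => ArithmeticFunction.vonMangoldt n / (n : ℝ) ^ x := by
  have h := (ArithmeticFunction.LSeriesSummable_vonMangoldt (s := (x : ℂ)) (by simpa)).norm
  refine h.congr fun n => ?_
  rcases eq_or_ne n 0 with rfl | hn
  · simp
  · have : (0 : ℝ) ≤ ArithmeticFunction.vonMangoldt n := ArithmeticFunction.vonMangoldt_nonneg
    rw [LSeries.term_of_ne_zero hn, norm_div, Complex.norm_real, Real.norm_of_nonneg this,
      Complex.norm_natCast_cpow_of_pos (Nat.pos_of_ne_zero hn), Complex.ofReal_re]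

open Complex in
theorem norm_natCast_cpow_mul_I {n : ℕ} (hn : n ≠ 0) (b : ℝ) : ‖(n : ℂ) ^ (b * I)‖ = 1 := by
  rw [norm_natCast_cpow_of_pos (Nat.pos_of_ne_zero hn)]
  simp

open Finset in
/-- The binomial expansion of the kernel `(‖1 + y‖ ^ 2 / 4) ^ m` on the unit circle. -/
theorem normSq_one_add_div_four_pow {y : ℂ} (hy : ‖y‖ = 1) (m : ℕ) :
    (((‖1 + y‖ ^ 2 / 4) ^ m : ℝ) : ℂ)
      = ∑ k ∈ range (2 * m + 1), ((2 * m).choose k : ℂ) / 4 ^ m * (y ^ k / y ^ m) := by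
  have hy0 : y ≠ 0 := by rintro rfl; simp at hy
  have h1 : ((‖1 + y‖ ^ 2 : ℝ) : ℂ) = (1 + y) ^ 2 / y := by
    rw [← Complex.normSq_eq_norm_sq, Complex.normSq_eq_conj_mul_self, map_add, map_one,
      ← Complex.inv_eq_conj hy]
    field_simp
    ring
  have h2 : (1 + y) ^ (2 * m) = ∑ k ∈ range (2 * m + 1), y ^ k * ((2 * m).choose k : ℂ) := by
    rw [add_comm, add_pow]
    simp
  rw [Complex.ofReal_pow, Complex.ofReal_div, h1, div_div, div_pow, ← pow_mul, h2, sum_div]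
  refine sum_congr rfl fun k _ => ?_
  push_cast
  rw [mul_pow]
  field_simp

-- The k-th binomial term gives the L-series at 1 + s + ib(m - k). As b ≠ 0, only k = m meets the
-- pole, so the limit is the mean of the kernel over the circle.
open Filter Topology ArithmeticFunction Complex Finset in
theorem tendsto_mul_tsum_vonMangoldt_kernel {b : ℝ} (hb : b ≠ 0) {u : ℂ} (hu : ‖u‖ = 1) (m : ℕ) :
    Tendsto (fun s : ℝ => s * ∑' n : ℕ, vonMangoldt n / (n : ℝ) ^ (1 + s) *
      (‖1 + (n : ℂ) ^ (b * I) / u‖ ^ 2 / 4) ^ m) (𝓝[>] 0) (𝓝 (m.centralBinom / 4 ^ m)) := by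
  have hu0 : u ≠ 0 := by rintro rfl; simp at hu
  have key : Tendsto (fun s : ℝ => ∑ k ∈ range (2 * m + 1),
      ((2 * m).choose k : ℂ) / 4 ^ m * (u ^ m / u ^ k) *
        (s * LSeries (fun n => (vonMangoldt n : ℂ)) (1 + s + (b * (m - k) : ℝ) * I))) (𝓝[>] 0)
      (𝓝 (∑ k ∈ range (2 * m + 1), ((2 * m).choose k : ℂ) / 4 ^ m * (u ^ m / u ^ k) *
        (if b * ((m : ℝ) - k) = 0 then 1 else 0))) :=
    tendsto_finsetSum _ fun k _ => (tendsto_mul_LSeries_vonMangoldt _).const_mul _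
  have hlim : (∑ k ∈ range (2 * m + 1), ((2 * m).choose k : ℂ) / 4 ^ m * (u ^ m / u ^ k) *
        (if b * ((m : ℝ) - k) = 0 then 1 else 0)) = ((m.centralBinom / 4 ^ m : ℝ) : ℂ) := by
    rw [sum_eq_single_of_mem m (by simp; omega)]
    · simp [hu0, Nat.centralBinom]
    · intro k _ hk
      have : (m : ℝ) - k ≠ 0 := sub_ne_zero.2 (by exact_mod_cast hk.symm)
      simp [hb, this]
  rw [hlim] at key
  have key' := (continuous_re.tendsto _).comp key
  rw [ofReal_re] at key'
  refine key'.congr' ?_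
  filter_upwards [self_mem_nhdsWithin] with s hs
  have hs : (0 : ℝ) < s := hs
  have hterm : ∀ n : ℕ, ((vonMangoldt n / (n : ℝ) ^ (1 + s) *
      (‖1 + (n : ℂ) ^ (b * I) / u‖ ^ 2 / 4) ^ m : ℝ) : ℂ) = ∑ k ∈ range (2 * m + 1),
      ((2 * m).choose k : ℂ) / 4 ^ m * (u ^ m / u ^ k) *
        LSeries.term (fun n => (vonMangoldt n : ℂ)) (1 + s + (b * (m - k) : ℝ) * I) n := by
    intro n
    rcases eq_or_ne n 0 with rfl | hn
    · simp
    have hnC : (n : ℂ) ≠ 0 := Nat.cast_ne_zero.2 hn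
    rw [ofReal_mul, normSq_one_add_div_four_pow
      (by rw [norm_div, hu, norm_natCast_cpow_mul_I hn, div_one]), mul_sum]
    refine sum_congr rfl fun k _ => ?_
    rw [LSeries.term_of_ne_zero hn]
    have h1 : (n : ℂ) ^ (1 + s + (b * (m - k) : ℝ) * I)
        = ((n : ℂ) ^ ((1 + s : ℝ) : ℂ)) * (((n : ℂ) ^ (b * I)) ^ m / ((n : ℂ) ^ (b * I)) ^ k) := by
      rw [← cpow_nat_mul, ← cpow_nat_mul, ← cpow_sub _ _ hnC, ← cpow_add _ _ hnC]
      congr 1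
      push_cast
      ring
    have h2 : (((n : ℝ) ^ (1 + s) : ℝ) : ℂ) = (n : ℂ) ^ ((1 + s : ℝ) : ℂ) := by
      rw [ofReal_cpow n.cast_nonneg, ofReal_natCast]
    have h3 : (n : ℂ) ^ (b * I) ≠ 0 := by simp [cpow_eq_zero_iff, hnC]
    have h4 : (n : ℂ) ^ ((1 + s : ℝ) : ℂ) ≠ 0 := by simp [cpow_eq_zero_iff, hnC]
    rw [h1, ofReal_div, h2, div_pow, div_pow]
    field_simp
  have hsum : ∀ k : ℕ, Summable (LSeries.term (fun n => (vonMangoldt n : ℂ))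
      (1 + s + (b * (m - k) : ℝ) * I)) := fun k =>
    LSeriesSummable_vonMangoldt (by simpa using hs)
  rw [Function.comp_apply, ← ofReal_re (s * _)]
  congr 1
  rw [ofReal_mul, ofReal_tsum]
  simp_rw [hterm]
  rw [Summable.tsum_finsetSum fun k _ => (hsum k).mul_left _, mul_sum]
  refine sum_congr rfl fun k _ => ?_
  rw [tsum_mul_left, LSeries]
  ring

open Filter Topology ArithmeticFunction Complex in
/-- The reciprocals of the primes whose rotation `p ^ (b i)` lies in a given arc are not summable. -/
theorem not_summable_inv_prime_arc {b : ℝ} (hb : b ≠ 0) {u : ℂ} (hu : ‖u‖ = 1) {ε : ℝ}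
    (hε : 0 < ε) :
    ¬ Summable (Set.indicator {p : ℕ | p.Prime ∧ ‖(p : ℂ) ^ (b * I) - u‖ < ε}
      fun p => (p : ℝ)⁻¹) := by
  intro hsum
  set A := {p : ℕ | p.Prime ∧ ‖(p : ℂ) ^ (b * I) - u‖ < ε} with hA
  have hu0 : u ≠ 0 := by rintro rfl; simp at hu
  have hΛ : ∀ n, 0 ≤ vonMangoldt n := fun n => vonMangoldt_nonneg
  -- By the parallelogram law the kernel base is 1 - ‖y - 1‖²/4.
  obtain ⟨q, hq0, hq1, hq⟩ : ∃ q : ℝ, 0 ≤ q ∧ q < 1 ∧ ∀ y : ℂ, ‖y‖ = 1 → ε ≤ ‖y - 1‖ →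
      ‖1 + y‖ ^ 2 / 4 ≤ q := by
    refine ⟨max 0 (1 - ε ^ 2 / 4), le_max_left _ _, max_lt one_pos (by nlinarith), ?_⟩
    intro y hy h
    refine le_max_of_le_right ?_
    have hp := parallelogram_law_with_norm ℝ 1 y
    rw [norm_sub_rev 1 y, hy, norm_one] at hp
    nlinarith
  -- The mean of the kernel is at least 1/(2m), which beats the exponentially small off-arc bound
  -- q^m.
  obtain ⟨m, hm0, hm⟩ : ∃ m : ℕ, 0 < m ∧ 2 * (m : ℝ) * q ^ m < 1 := by
    have h : Tendsto (fun n : ℕ => (n : ℝ) ^ 1 * q ^ n) atTop (𝓝 0) :=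
      tendsto_pow_const_mul_const_pow_of_abs_lt_one 1 (by rwa [abs_of_nonneg hq0])
    obtain ⟨m, h1, h2⟩ := ((h.eventually_lt_const (show (0 : ℝ) < 1 / 2 by norm_num)).and
      (eventually_gt_atTop 0)).exists
    exact ⟨m, h2, by rw [pow_one] at h1; linarith⟩
  have hcb : q ^ m < m.centralBinom / 4 ^ m := by
    rw [lt_div_iff₀ (by positivity)]
    have h4 : (4 : ℝ) ^ m ≤ 2 * m * m.centralBinom := by
      exact_mod_cast Nat.four_pow_le_two_mul_self_mul_centralBinom m hm0
    have hc : (0 : ℝ) < m.centralBinom := by exact_mod_cast m.centralBinom_pos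
    have : 0 ≤ q ^ m := pow_nonneg hq0 m
    nlinarith
  set K : ℕ → ℝ := fun n => (‖1 + (n : ℂ) ^ (b * I) / u‖ ^ 2 / 4) ^ m with hK
  set P : ℝ → ℕ → ℝ := fun s => A.indicator fun n => s * (vonMangoldt n / (n : ℝ) ^ (1 + s))
    with hP
  set N : ℕ → ℝ := fun n =>
    (if n.Prime then 0 else vonMangoldt.residueClass (1 : ZMod 1) n) / n with hN
  have hNsum : Summable N := vonMangoldt.summable_residueClass_non_primes_div 1
  have hres : ∀ n, vonMangoldt.residueClass (1 : ZMod 1) n = vonMangoldt n := fun n => by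
    simp [vonMangoldt.residueClass, Set.indicator, Subsingleton.elim (n : ZMod 1) 1]
  have hPnonneg : ∀ s : ℝ, 0 < s → ∀ n, 0 ≤ P s n := fun s hs n =>
    Set.indicator_nonneg (fun n _ => by have := hΛ n; positivity) n
  -- Since s log p ≤ p^s, the assumed summable 1/p dominates uniformly in s; hence the primes of the
  -- arc contribute 0 in the limit.
  have hPle : ∀ s : ℝ, 0 < s → ∀ n, P s n ≤ A.indicator (fun p => (p : ℝ)⁻¹) n := by
    intro s hs n
    refine Set.indicator_le_indicator' ?_
    rintro ⟨hn, -⟩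
    have hn0 : (0 : ℝ) < n := by exact_mod_cast hn.pos
    rw [vonMangoldt_apply_prime hn, Real.rpow_add hn0, Real.rpow_one]
    have := Real.log_le_rpow_div hn0.le hs
    rw [le_div_iff₀ hs] at this
    have hr : 0 < (n : ℝ) ^ s := Real.rpow_pos_of_pos hn0 s
    rw [← mul_div_assoc, div_le_iff₀ (by positivity), inv_mul_cancel_left₀ hn0.ne']
    linarith
  have hPsum : ∀ s : ℝ, 0 < s → Summable (P s) := fun s hs =>
    Summable.of_nonneg_of_le (hPnonneg s hs) (hPle s hs) hsum
  have hPlim : Tendsto (fun s => ∑' n, P s n) (𝓝[>] 0) (𝓝 0) := by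
    have h := tendsto_tsum_of_dominated_convergence (𝓕 := 𝓝[>] (0 : ℝ)) (f := P)
      (g := fun _ => 0) hsum (fun n => ?_) ?_
    · simpa using h
    · by_cases hn : n ∈ A
      · simp only [hP, Set.indicator_of_mem hn]
        have hn0 : (n : ℝ) ≠ 0 := Nat.cast_ne_zero.2 hn.1.ne_zero
        have hc : ContinuousAt (fun s : ℝ => s * (vonMangoldt n / (n : ℝ) ^ (1 + s))) 0 := by
          refine continuousAt_id.mul (continuousAt_const.div ?_ (by simp [hn0]))
          exact continuousAt_const.rpow (continuousAt_const.add continuousAt_id) (Or.inl hn0)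
        simpa using hc.tendsto.mono_left nhdsWithin_le_nhds
      · simp [hP, hn]
    · filter_upwards [self_mem_nhdsWithin] with s hs n
      rw [Real.norm_of_nonneg (hPnonneg s hs n)]
      exact hPle s hs n
  -- Three contributions: primes in the arc, non-primes in the arc (bounded by the summable `N`),
  -- and the rest, where the kernel is at most q^m. As s → 0 this would bound the mean by q^m.
  have hpoint : ∀ s : ℝ, 0 < s → ∀ n : ℕ, s * (vonMangoldt n / (n : ℝ) ^ (1 + s) * K n)
      ≤ P s n + s * N n + q ^ m * (s * (vonMangoldt n / (n : ℝ) ^ (1 + s) * 1)) := by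
    intro s hs n
    have hN0 : 0 ≤ N n := by simp only [hN, hres]; positivity [hΛ n]
    have hw : 0 ≤ vonMangoldt n / (n : ℝ) ^ (1 + s) := by positivity [hΛ n]
    have hq' : 0 ≤ q ^ m := pow_nonneg hq0 m
    rcases eq_or_ne n 0 with rfl | hn
    · simpa using add_nonneg (hPnonneg s hs 0) (mul_nonneg hs.le hN0)
    have hy : ‖(n : ℂ) ^ (b * I) / u‖ = 1 := by
      rw [norm_div, hu, norm_natCast_cpow_mul_I hn, div_one]
    by_cases harc : ‖(n : ℂ) ^ (b * I) - u‖ < ε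
    · have hK1 : K n ≤ 1 := by
        refine pow_le_one₀ (by positivity) ?_
        have : ‖1 + (n : ℂ) ^ (b * I) / u‖ ≤ 2 := by
          refine (norm_add_le _ _).trans ?_
          rw [hy, norm_one]; norm_num
        have h0 := norm_nonneg (1 + (n : ℂ) ^ (b * I) / u)
        nlinarith
      have hle : s * (vonMangoldt n / (n : ℝ) ^ (1 + s)) ≤ P s n + s * N n := by
        by_cases hp : n.Prime
        · have hm : n ∈ A := ⟨hp, harc⟩
          simp only [hP, Set.indicator_of_mem hm]
          have := mul_nonneg hs.le hN0
          linarith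
        · have h1 : vonMangoldt n / (n : ℝ) ^ (1 + s) ≤ N n := by
            simp only [hN, if_neg hp, hres]
            have h1n : (1 : ℝ) ≤ n := by exact_mod_cast Nat.pos_of_ne_zero hn
            refine div_le_div_of_nonneg_left (hΛ n) (by linarith) ?_
            conv_lhs => rw [← Real.rpow_one n]
            exact Real.rpow_le_rpow_of_exponent_le h1n (by linarith)
          have := mul_le_mul_of_nonneg_left h1 hs.le
          have := hPnonneg s hs n
          linarith
      have h1 := mul_le_mul_of_nonneg_left hK1 (mul_nonneg hs.le hw)
      have h2 := mul_nonneg hq' (mul_nonneg hs.le hw)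
      linarith
    · have hKq : K n ≤ q ^ m := by
        refine pow_le_pow_left₀ (by positivity) (hq _ hy ?_) m
        rw [div_sub_one hu0, norm_div, hu, div_one]
        exact not_lt.1 harc
      have h1 := mul_le_mul_of_nonneg_left hKq (mul_nonneg hs.le hw)
      have h2 := hPnonneg s hs n
      have h3 := mul_nonneg hs.le hN0
      linarith
  have hKlim := tendsto_mul_tsum_vonMangoldt_kernel hb hu m
  have h1lim := tendsto_mul_tsum_vonMangoldt_kernel hb hu 0
  simp only [pow_zero, Nat.centralBinom_zero, Nat.cast_one, div_one] at h1lim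
  have hs0 : Tendsto (fun s : ℝ => s) (𝓝[>] 0) (𝓝 0) := tendsto_id.mono_left nhdsWithin_le_nhds
  have hrhs := (hPlim.add (hs0.mul_const (∑' n, N n))).add (h1lim.const_mul (q ^ m))
  refine absurd (le_of_tendsto_of_tendsto hKlim hrhs ?_) (by simpa using hcb)
  filter_upwards [self_mem_nhdsWithin] with s hs
  have hs : (0 : ℝ) < s := hs
  have hΛsum := summable_vonMangoldt_div_rpow (show 1 < 1 + s by linarith)
  have hB : Summable fun n : ℕ =>
      P s n + s * N n + q ^ m * (s * (vonMangoldt n / (n : ℝ) ^ (1 + s) * 1)) :=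
    ((hPsum s hs).add (hNsum.mul_left s)).add (((hΛsum.mul_right 1).mul_left s).mul_left _)
  have hK0 : ∀ n : ℕ, 0 ≤ s * (vonMangoldt n / (n : ℝ) ^ (1 + s) * K n) := fun n => by
    positivity [hΛ n]
  rw [← tsum_mul_left, ← tsum_mul_left, ← tsum_mul_left, ← tsum_mul_left,
    ← (hPsum s hs).tsum_add (hNsum.mul_left s),
    ← ((hPsum s hs).add (hNsum.mul_left s)).tsum_add
      (((hΛsum.mul_right 1).mul_left s).mul_left _)]
  exact Summable.tsum_le_tsum (hpoint s hs) (Summable.of_nonneg_of_le hK0 (hpoint s hs) hB) hB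

open Complex in
theorem infinite_prime_arc {b : ℝ} (hb : b ≠ 0) {u : ℂ} (hu : ‖u‖ = 1) {ε : ℝ} (hε : 0 < ε) :
    {p : ℕ | p.Prime ∧ ‖(p : ℂ) ^ (b * I) - u‖ < ε}.Infinite := fun hfin =>
  not_summable_inv_prime_arc hb hu hε
    (summable_of_hasFiniteSupport (hfin.subset Set.support_indicator_subset))

/-! ### Multiplicativity and squarefree products -/

theorem divisorSigma_mul_of_coprime (c : ℂ) {m n : ℕ} (h : m.Coprime n) :
    divisorSigma c (m * n) = divisorSigma c m * divisorSigma c n := by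
  simp only [divisorSigma]
  rw [Nat.divisors_mul, Finset.mul_def, Finset.sum_image h.mul_injOn_divisors,
    Finset.sum_mul_sum, Finset.sum_product]
  simp_rw [Nat.cast_mul, Complex.natCast_mul_natCast_cpow]

theorem divisorSigma_one (c : ℂ) : divisorSigma c 1 = 1 := by simp [divisorSigma]

theorem divisorSigma_prime (c : ℂ) {p : ℕ} (hp : p.Prime) :
    divisorSigma c p = 1 + (p : ℂ) ^ c := by
  rw [divisorSigma, hp.sum_divisors, Nat.cast_one, Complex.one_cpow, add_comm]

theorem one_mem_squarefreeRough (D : ℕ) : 1 ∈ squarefreeRough D :=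
  ⟨squarefree_one, fun _ hp h => absurd (Nat.dvd_one.1 h) hp.one_lt.ne'⟩

theorem prime_mem_squarefreeRough {D p : ℕ} (hp : p.Prime) (h : D < p) :
    p ∈ squarefreeRough D :=
  ⟨hp.prime.irreducible.squarefree, fun q hq hqp => by
    rwa [(Nat.prime_dvd_prime_iff_eq hq hp).1 hqp]⟩

theorem mul_mem_squarefreeRough {D m n : ℕ} (hm : m ∈ squarefreeRough D)
    (hn : n ∈ squarefreeRough D) (h : m.Coprime n) : m * n ∈ squarefreeRough D :=
  ⟨(Nat.squarefree_mul_iff.2 ⟨h, hm.1, hn.1⟩), fun p hp hpd =>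
    (hp.dvd_mul.1 hpd).elim (hm.2 p hp) (hn.2 p hp)⟩

theorem prod_primes_mem_squarefreeRough (c : ℂ) {D : ℕ} (F : Finset ℕ)
    (hF : ∀ p ∈ F, p.Prime ∧ D < p) :
    ∏ p ∈ F, p ∈ squarefreeRough D ∧
      divisorSigma c (∏ p ∈ F, p) = ∏ p ∈ F, (1 + (p : ℂ) ^ c) := by
  induction F using Finset.induction_on with
  | empty => simpa using ⟨one_mem_squarefreeRough D, divisorSigma_one c⟩
  | insert p F hp ih =>
    obtain ⟨h1, h2⟩ := ih fun q hq => hF q (Finset.mem_insert_of_mem hq)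
    obtain ⟨hpp, hpD⟩ := hF p (Finset.mem_insert_self p F)
    have hcop : p.Coprime (∏ q ∈ F, q) := Nat.Coprime.prod_right fun q hq =>
      (Nat.coprime_primes hpp (hF q (Finset.mem_insert_of_mem hq)).1).2 (by rintro rfl; exact hp hq)
    rw [Finset.prod_insert hp, Finset.prod_insert hp, divisorSigma_mul_of_coprime c hcop,
      divisorSigma_prime c hpp, h2]
    exact ⟨mul_mem_squarefreeRough (prime_mem_squarefreeRough hpp hpD) h1 hcop, rfl⟩

/-! ### Negative real part: steering sums of logarithms -/

theorem exists_sum_range_mem_Icc {f : ℕ → ℝ} (hf : ∀ n, 0 ≤ f n) (hsum : ¬ Summable f)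
    {δ τ : ℝ} (hδ : ∀ n, f n ≤ δ) (hτ : 0 < τ) :
    ∃ n, ∑ i ∈ Finset.range n, f i ∈ Set.Icc τ (τ + δ) := by
  have hex : ∃ n, τ ≤ ∑ i ∈ Finset.range n, f i :=
    (((not_summable_iff_tendsto_nat_atTop_of_nonneg hf).1 hsum).eventually_ge_atTop τ).exists
  classical
  refine ⟨Nat.find hex, Nat.find_spec hex, ?_⟩
  obtain ⟨k, hk⟩ : ∃ k, Nat.find hex = k + 1 := Nat.exists_eq_succ_of_ne_zero fun h => by
    have := Nat.find_spec hex
    rw [h, Finset.sum_range_zero] at this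
    linarith
  have hlt := Nat.find_min hex (m := k) (by omega)
  rw [hk, Finset.sum_range_succ]
  linarith [hδ k]

open Complex in
theorem natCast_cpow_eq_rpow_re_mul {n : ℕ} (hn : n ≠ 0) (c : ℂ) :
    (n : ℂ) ^ c = ((n : ℝ) ^ c.re : ℝ) * (n : ℂ) ^ (c.im * I) := by
  rw [ofReal_cpow n.cast_nonneg, ofReal_natCast, ← cpow_add _ _ (Nat.cast_ne_zero.2 hn), re_add_im]

open Complex Filter in
/-- Summing `log (1 + p ^ c)` over primes with `p ^ (i im c)` close to the direction of `r`
approximates `r` up to half of its length. -/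
theorem exists_sum_log_one_add_prime_cpow_near {c : ℂ} (h1 : -1 ≤ c.re) (h0 : c.re < 0)
    (hb : c.im ≠ 0) (N : ℕ) {r : ℂ} (hr : r ≠ 0) :
    ∃ F : Finset ℕ, (∀ p ∈ F, p.Prime ∧ N < p) ∧
      ‖∑ p ∈ F, log (1 + (p : ℂ) ^ c) - r‖ ≤ ‖r‖ / 2 := by
  have hτ : 0 < ‖r‖ := norm_pos_iff.2 hr
  set u : ℂ := r / ‖r‖ with hu_def
  have hu : ‖u‖ = 1 := by simp [hu_def, hr]
  have hru : r = ‖r‖ * u := by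
    rw [hu_def, mul_div_cancel₀]
    exact_mod_cast hτ.ne'
  -- Error budget: each prime costs x/8 for the logarithm and x/8 for the direction, where x = p^a;
  -- the overshoot is at most ‖r‖/8. The total is at most 13‖r‖/32.
  set δ : ℝ := min (‖r‖ / 8) (1 / 8) with hδ
  have hδ0 : 0 < δ := by positivity
  set B : Set ℕ := {p : ℕ | p.Prime ∧ ‖(p : ℂ) ^ (c.im * I) - u‖ < 1 / 8} with hB
  set A : Set ℕ := {p : ℕ | p ∈ B ∧ N < p ∧ (p : ℝ) ^ c.re ≤ δ} with hA
  have hlim : Tendsto (fun n : ℕ => (n : ℝ) ^ c.re) atTop (nhds 0) := by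
    have := (tendsto_rpow_neg_atTop (neg_pos.2 h0)).comp tendsto_natCast_atTop_atTop
    simpa [Function.comp_def] using this
  have hnot : ¬ Summable (A.indicator fun p : ℕ => (p : ℝ) ^ c.re) := by
    intro h
    refine not_summable_inv_prime_arc hb hu (by norm_num : (0 : ℝ) < 1 / 8) ?_
    refine Summable.of_norm_bounded_eventually_nat h ?_
    filter_upwards [eventually_gt_atTop N, hlim.eventually_le_const hδ0] with n hn1 hn2
    by_cases hnB : n ∈ B
    · have hnA : n ∈ A := ⟨hnB, hn1, hn2⟩
      rw [Set.indicator_of_mem hnA]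
      change ‖B.indicator _ n‖ ≤ _
      have h1n : (1 : ℝ) ≤ n := by exact_mod_cast hnB.1.one_lt.le
      rw [Set.indicator_of_mem hnB, Real.norm_of_nonneg (by positivity), ← Real.rpow_neg_one]
      exact Real.rpow_le_rpow_of_exponent_le h1n h1
    · change ‖B.indicator _ n‖ ≤ _
      rw [Set.indicator_of_notMem hnB, norm_zero]
      exact Set.indicator_nonneg (fun n _ => by positivity) n
  obtain ⟨n, hn1, hn2⟩ := exists_sum_range_mem_Icc (δ := δ) (τ := ‖r‖)
    (fun n => Set.indicator_nonneg (fun n _ => by positivity) n) hnot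
    (fun n => Set.indicator_apply_le' (fun h => h.2.2) fun _ => hδ0.le) hτ
  classical
  have hfilter : ∑ i ∈ Finset.range n, A.indicator (fun p : ℕ => (p : ℝ) ^ c.re) i
      = ∑ p ∈ (Finset.range n).filter (· ∈ A), (p : ℝ) ^ c.re := by
    rw [Finset.sum_filter]
    exact Finset.sum_congr rfl fun i _ => Set.indicator_apply _ _ _
  rw [hfilter] at hn1 hn2
  set F := (Finset.range n).filter (· ∈ A) with hF
  have hFA : ∀ p ∈ F, p ∈ A := fun p hp => (Finset.mem_filter.1 hp).2
  refine ⟨F, fun p hp => ⟨(hFA p hp).1.1, (hFA p hp).2.1⟩, ?_⟩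
  have hterm : ∀ p ∈ F, ‖log (1 + (p : ℂ) ^ c) - ((p : ℝ) ^ c.re : ℝ) * u‖
      ≤ (p : ℝ) ^ c.re / 4 := by
    intro p hp
    obtain ⟨⟨hpp, harc⟩, -, hpδ⟩ := hFA p hp
    have hx0 : 0 < (p : ℝ) ^ c.re := Real.rpow_pos_of_pos (by exact_mod_cast hpp.pos) _
    set x := (p : ℝ) ^ c.re with hx
    have hx8 : x ≤ 1 / 8 := hpδ.trans (min_le_right _ _)
    have hnorm : ‖(p : ℂ) ^ c‖ = x := norm_natCast_cpow_of_pos hpp.pos c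
    have hlog : ‖log (1 + (p : ℂ) ^ c) - (p : ℂ) ^ c‖ ≤ x / 8 := by
      refine (norm_log_one_add_sub_self_le (by rw [hnorm]; linarith)).trans ?_
      have hinv : (1 - x)⁻¹ ≤ 2 := by
        rw [inv_le_comm₀ (by linarith) two_pos]
        linarith
      rw [hnorm]
      nlinarith [mul_le_mul_of_nonneg_left hinv (sq_nonneg x)]
    have hrot : ‖(p : ℂ) ^ c - (x : ℂ) * u‖ ≤ x / 8 := by
      rw [natCast_cpow_eq_rpow_re_mul hpp.ne_zero c, ← hx, ← mul_sub, norm_mul, norm_real,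
        Real.norm_of_nonneg hx0.le]
      nlinarith
    have := norm_sub_le_norm_sub_add_norm_sub (log (1 + (p : ℂ) ^ c)) ((p : ℂ) ^ c) ((x : ℂ) * u)
    linarith
  set T := ∑ p ∈ F, (p : ℝ) ^ c.re with hT
  have hsplit : ∑ p ∈ F, log (1 + (p : ℂ) ^ c) - r
      = ∑ p ∈ F, (log (1 + (p : ℂ) ^ c) - ((p : ℝ) ^ c.re : ℝ) * u) + ((T - ‖r‖ : ℝ) : ℂ) * u := by
    rw [Finset.sum_sub_distrib, ← Finset.sum_mul, ← ofReal_sum, ← hT, ofReal_sub, sub_mul, ← hru]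
    ring
  have hb1 : ‖∑ p ∈ F, (log (1 + (p : ℂ) ^ c) - ((p : ℝ) ^ c.re : ℝ) * u)‖ ≤ T / 4 := by
    rw [hT, Finset.sum_div]
    exact norm_sum_le_of_le _ hterm
  have hb2 : ‖((T - ‖r‖ : ℝ) : ℂ) * u‖ = T - ‖r‖ := by
    rw [norm_mul, hu, mul_one, norm_real, Real.norm_of_nonneg (by linarith)]
  have hδr : δ ≤ ‖r‖ / 8 := min_le_left _ _
  rw [hsplit]
  refine (norm_add_le _ _).trans ?_
  linarith

open Complex in
theorem exists_sum_log_one_add_prime_cpow_le {c : ℂ} (h1 : -1 ≤ c.re) (h0 : c.re < 0)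
    (hb : c.im ≠ 0) (D : ℕ) (w : ℂ) (k : ℕ) :
    ∃ F : Finset ℕ, (∀ p ∈ F, p.Prime ∧ D < p) ∧
      ‖∑ p ∈ F, log (1 + (p : ℂ) ^ c) - w‖ ≤ ‖w‖ / 2 ^ k := by
  classical
  induction k with
  | zero => exact ⟨∅, by simp, by simp⟩
  | succ k ih =>
    obtain ⟨F, hF, hFw⟩ := ih
    set r := w - ∑ p ∈ F, log (1 + (p : ℂ) ^ c) with hr
    rw [norm_sub_rev, ← hr] at hFw
    rcases eq_or_ne r 0 with h | h
    · refine ⟨F, hF, ?_⟩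
      rw [norm_sub_rev, ← hr, h, norm_zero]
      positivity
    -- Taking only primes beyond those already used keeps the product squarefree.
    obtain ⟨G, hG, hGr⟩ := exists_sum_log_one_add_prime_cpow_near h1 h0 hb (D + F.sup id) h
    have hdisj : Disjoint F G := Finset.disjoint_left.2 fun p hpF hpG => by
      have h1 : p ≤ F.sup id := Finset.le_sup (f := id) hpF
      have h2 := (hG p hpG).2
      omega
    refine ⟨F ∪ G, fun p hp => ?_, ?_⟩
    · rcases Finset.mem_union.1 hp with hp | hp
      · exact hF p hp
      · exact ⟨(hG p hp).1, by have := (hG p hp).2; omega⟩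
    · rw [Finset.sum_union hdisj,
        show ∑ p ∈ F, log (1 + (p : ℂ) ^ c) + ∑ p ∈ G, log (1 + (p : ℂ) ^ c) - w
          = ∑ p ∈ G, log (1 + (p : ℂ) ^ c) - r by rw [hr]; ring]
      refine hGr.trans ?_
      rw [pow_succ, ← div_div]
      linarith

theorem dense_of_forall_ne_zero_mem_closure {S : Set ℂ} (h : ∀ z ≠ 0, z ∈ closure S) : Dense S := by
  have h0 : Dense ({0}ᶜ : Set ℂ) := dense_compl_singleton 0
  exact dense_closure.1 (h0.mono fun z hz => h z hz)

open Complex Filter Topology in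
theorem dense_divisorSigma_of_re_neg {c : ℂ} (h1 : -1 ≤ c.re) (h0 : c.re < 0)
    (hb : c.im ≠ 0) (D : ℕ) : Dense (divisorSigma c '' squarefreeRough D) := by
  refine dense_of_forall_ne_zero_mem_closure fun z hz => ?_
  choose F hF hFz using exists_sum_log_one_add_prime_cpow_le h1 h0 hb D (log z)
  have hlim : Tendsto (fun k => ∑ p ∈ F k, log (1 + (p : ℂ) ^ c)) atTop (𝓝 (log z)) := by
    rw [tendsto_iff_norm_sub_tendsto_zero]
    refine squeeze_zero (fun _ => norm_nonneg _) hFz ?_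
    have := (tendsto_pow_atTop_nhds_zero_of_lt_one (r := (1 / 2 : ℝ)) (by norm_num)
      (by norm_num)).const_mul ‖log z‖
    simpa [div_eq_mul_inv] using this
  have hexp := (continuous_exp.tendsto _).comp hlim
  rw [exp_log hz] at hexp
  refine mem_closure_of_tendsto hexp (Eventually.of_forall fun k => ?_)
  obtain ⟨hm, hv⟩ := prod_primes_mem_squarefreeRough c (F k) (hF k)
  refine ⟨_, hm, ?_⟩
  rw [hv, Function.comp_apply, exp_sum]
  refine Finset.prod_congr rfl fun p hp => (exp_log fun h => ?_).symm
  have hp1 : (1 : ℝ) < p := by exact_mod_cast (hF k p hp).1.one_lt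
  have hlt : ‖(p : ℂ) ^ c‖ < 1 := by
    rw [norm_natCast_cpow_of_pos (hF k p hp).1.pos]
    exact Real.rpow_lt_one_of_one_lt_of_neg hp1 h0
  rw [eq_neg_of_add_eq_zero_right h, norm_neg, norm_one] at hlt
  exact lt_irrefl _ hlt

/-! ### Zero real part: products of circle points -/

open Complex Filter Topology in
theorem mul_one_add_mem_closure_divisorSigma {c : ℂ} (h0 : c.re = 0) (hb : c.im ≠ 0) {D : ℕ}
    {z u : ℂ} (hz : z ∈ closure (divisorSigma c '' squarefreeRough D)) (hu : ‖u‖ = 1) :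
    z * (1 + u) ∈ closure (divisorSigma c '' squarefreeRough D) := by
  rw [← closure_closure]
  refine map_mem_closure (f := fun x => x * (1 + u)) (by fun_prop) hz ?_
  rintro _ ⟨n, hn, rfl⟩
  have hu' : u ∈ closure ((fun p : ℕ => (p : ℂ) ^ c) '' {p | p.Prime ∧ D < p ∧ n < p}) := by
    refine Metric.mem_closure_iff.2 fun ε hε => ?_
    obtain ⟨p, ⟨hp, hpu⟩, hlt⟩ := (infinite_prime_arc hb hu hε).exists_gt (D + n)
    refine ⟨_, ⟨p, ⟨hp, by omega, by omega⟩, rfl⟩, ?_⟩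
    have hc : c = c.im * I := by
      conv_lhs => rw [← re_add_im c, h0, ofReal_zero, zero_add]
    rw [dist_comm, dist_eq, hc]
    simpa using hpu
  refine map_mem_closure (f := fun x => divisorSigma c n * (1 + x)) (by fun_prop) hu' ?_
  rintro _ ⟨p, ⟨hp, hpD, hpn⟩, rfl⟩
  have hcop : n.Coprime p := ((hp.coprime_iff_not_dvd).2
    (Nat.not_dvd_of_pos_of_lt (Nat.pos_of_ne_zero hn.1.ne_zero) hpn)).symm
  exact ⟨n * p, mul_mem_squarefreeRough hn (prime_mem_squarefreeRough hp hpD) hcop,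
    by rw [divisorSigma_mul_of_coprime c hcop, divisorSigma_prime c hp]⟩

open Complex in
/-- Near `1`, every complex number is a product of two points of the circle `|w - 1| = 1`. -/
theorem exists_mul_one_add_eq {ρ θ : ℝ} (h1 : -1 ≤ ρ / 2 - Real.cos θ)
    (h2 : ρ / 2 - Real.cos θ ≤ 1) :
    ∃ u v : ℂ, ‖u‖ = 1 ∧ ‖v‖ = 1 ∧ (1 + u) * (1 + v) = ρ * exp (θ * I) := by
  -- The product of 1 + e^(i(θ+d)) and 1 + e^(i(θ-d)) is e^(iθ)(2 cos θ + 2 cos d).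
  set d := Real.arccos (ρ / 2 - Real.cos θ) with hd
  refine ⟨exp ((θ + d : ℝ) * I), exp ((θ - d : ℝ) * I), norm_exp_ofReal_mul_I _,
    norm_exp_ofReal_mul_I _, ?_⟩
  have hcd : (ρ : ℂ) = 2 * cos θ + 2 * cos d := by
    have := Real.cos_arccos h1 h2
    rw [← hd] at this
    have : ρ = 2 * Real.cos θ + 2 * Real.cos d := by linarith
    rw [this]
    push_cast
    ring
  have e1 : exp ((θ + d : ℝ) * I) = exp (θ * I) * exp (d * I) := by
    rw [← exp_add]; congr 1; push_cast; ring
  have e2 : exp ((θ - d : ℝ) * I) = exp (θ * I) * exp (-d * I) := by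
    rw [← exp_add]; congr 1; push_cast; ring
  have e3 : exp (θ * I) * exp (-θ * I) = 1 := by rw [← exp_add]; simp
  have e4 : exp (d * I) * exp (-d * I) = 1 := by rw [← exp_add]; simp
  rw [hcd, two_cos, two_cos, e1, e2]
  linear_combination (exp (θ * I)) ^ 2 * e4 - e3

open Complex Filter Topology in
theorem dense_divisorSigma_of_re_eq_zero {c : ℂ} (h0 : c.re = 0) (hb : c.im ≠ 0) (D : ℕ) :
    Dense (divisorSigma c '' squarefreeRough D) := by
  refine dense_of_forall_ne_zero_mem_closure fun z hz => ?_
  have hz0 : 0 < ‖z‖ := norm_pos_iff.2 hz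
  have hinv : Tendsto (fun n : ℕ => (n : ℝ)⁻¹) atTop (𝓝 0) := tendsto_inv_atTop_nhds_zero_nat
  -- The n-th root of z tends to 1, so this tends to -1/2, inside the domain of arccos.
  have hlim : Tendsto (fun n : ℕ => ‖z‖ ^ (n : ℝ)⁻¹ / 2 - Real.cos (arg z * (n : ℝ)⁻¹)) atTop
      (𝓝 (‖z‖ ^ (0 : ℝ) / 2 - Real.cos (arg z * 0))) :=
    ((tendsto_const_nhds.rpow hinv (Or.inl hz0.ne')).div_const 2).sub
      ((Real.continuous_cos.tendsto _).comp (hinv.const_mul (arg z)))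
  rw [Real.rpow_zero, mul_zero, Real.cos_zero] at hlim
  obtain ⟨n, ⟨hn1, hn2⟩, hn0⟩ := (((hlim.eventually_const_le (by norm_num : (-1 : ℝ) < _)).and
    (hlim.eventually_le_const (by norm_num : _ < (1 : ℝ)))).and (eventually_gt_atTop 0)).exists
  have hnR : (n : ℝ) ≠ 0 := by exact_mod_cast hn0.ne'
  obtain ⟨u, v, hu, hv, huv⟩ := exists_mul_one_add_eq hn1 hn2
  have hpow : ((1 + u) * (1 + v)) ^ n = z := by
    rw [huv, mul_pow, ← ofReal_pow, Real.rpow_inv_natCast_pow hz0.le hn0.ne', ← exp_nat_mul]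
    conv_rhs => rw [← norm_mul_exp_arg_mul_I z]
    congr 2
    push_cast
    have : (n : ℂ) ≠ 0 := by exact_mod_cast hn0.ne'
    field_simp
  have hall : ∀ k : ℕ, ((1 + u) * (1 + v)) ^ k ∈ closure (divisorSigma c '' squarefreeRough D) := by
    intro k
    induction k with
    | zero => exact subset_closure ⟨1, one_mem_squarefreeRough D, by simp [divisorSigma_one]⟩
    | succ k ih =>
      rw [pow_succ, ← mul_assoc]
      exact mul_one_add_mem_closure_divisorSigma h0 hb
        (mul_one_add_mem_closure_divisorSigma h0 hb ih hu) hv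
  exact hpow ▸ hall n

theorem corollary3p1 (c : ℂ) (ha₁ : -1 ≤ c.re) (ha₂ : c.re ≤ 0) (hb : c.im ≠ 0)
    (D : ℕ) (hD : 0 < D) :
    Dense (divisorSigma c '' squarefreeRough D) := by
  rcases ha₂.lt_or_eq with h | h
  · exact dense_divisorSigma_of_re_neg ha₁ h hb D
  · exact dense_divisorSigma_of_re_eq_zero h hb D
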